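/- Let $p\ge 1$, $n\ge 0$ be integers and $\alpha\in(0,1]$. Let $\boldsymbol\pi=(\pi_1,\dots,\pi_p)$ be a probability vector and $\boldsymbol T$ a $p\times p$ sub-intensity matrix (nonnegative off-diagonal entries, and $\boldsymbol t:=-\boldsymbol T\boldsymbol e\ge 0$ with $\boldsymbol e=(1,\dots,1)^T$) such that the states $1,\dots,p$ are transient, i.e. from each of them the absorbing state $p+1$ is accessible for the Markov chain with intensity matrix $\begin{pmatrix}\boldsymbol T&\boldsymbol t\\ \boldsymbol 0&0\end{pmatrix}$. Let $\boldsymbol R=(r_{ik})$ be a $p\times n$ matrix with nonnegative entries. Write $\boldsymbol\Delta(\boldsymbol v)$ for the diagonal matrix with diagonal $\boldsymbol v$. For a $p\times m$ matrix $\boldsymbol A=(a_{ik})$, $\mathrm{MPH}^*(\boldsymbol\pi,\boldsymbol T,\boldsymbol A)$ denotes the law of the vector $\big(\int_0^\tau\sum_{i=1}^p a_{ik}1\{X_s=i\}\,ds\big)_{k=1,\dots,m}$, where $(X_s)_{s\ge0}$ is a (right-continuous) Markov jump process on $\{1,\dots,p+1\}$ with the above intensity matrix and with initial distribution $\boldsymbol\pi$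 on $\{1,\dots,p\}$, and $\tau=\inf\{s>0: X_s=p+1\}$. Let $\boldsymbol Y=(Y_1,\dots,Y_n)$ be a random vector with the Laplace transform of $\mathrm{MPH}^*_\alpha(\boldsymbol\pi,\boldsymbol T,\boldsymbol R)$, i.e. $$\mathbb E\, e^{-\langle \boldsymbol Y,\boldsymbol\theta\rangle}=\boldsymbol\pi\big(\boldsymbol\Delta(\boldsymbol R\boldsymbol\theta)^\alpha-\boldsymbol T\big)^{-1}\boldsymbol t\qquad\text{for all }\boldsymbol\theta\in[0,\infty)^n .$$ Let $\boldsymbol W=(W_1,\dots,W_p)\sim\mathrm{MPH}^*(\boldsymbol\pi,\boldsymbol T,\boldsymbol I)$, and let $\boldsymbol S_\alpha=(S_\alpha^1,\dots,S_\alpha^p)$, independent of $\boldsymbol W$, be a vector of independent positive stable random variables, each with $\mathbb E\,e^{-uS_\alpha^i}=\exp(-u^\alpha)$ for all $u\ge0$. Then $$\boldsymbol Y\stackrel{d}{=}\boldsymbol R^T\big(\boldsymbol W^{1/\alpha}\bullet\boldsymbol S_\alpha\big),$$ where $\boldsymbol W^{1/\alpha}=(W_1^{1/\alpha},\dots,W_p^{1/\alpha})$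 and $\bullet$ is the entrywise product; that is, $Y_k$, $k=1,\dots,n$, are jointly distributed as $\sum_{i=1}^p r_{ik}W_i^{1/\alpha}S_\alpha^i$, $k=1,\dots,n$. -/

import Mathlib

open MeasureTheory ProbabilityTheory Matrix
open scoped NNReal ENNReal

universe u v w

namespace PhaseType

noncomputable section

/-- The exit rate vector `t = -T e`, where `e` is the vector of ones. -/
def exitRate {p : ℕ} (T : Matrix (Fin p) (Fin p) ℝ) : Fin p → ℝ :=
  -(T *ᵥ 1)

/-- The state space: `Sum.inl i` are the `p` transient states, `Sum.inr ()` is the absorbing one. -/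
abbrev State (p : ℕ) : Type := Fin p ⊕ Unit

/-- The intensity matrix with blocks `T`, `t`, `0`, `0` on the states including the absorbing one. -/
def intensity {p : ℕ} (T : Matrix (Fin p) (Fin p) ℝ) : Matrix (State p) (State p) ℝ :=
  Matrix.fromBlocks T (Matrix.of fun i _ => exitRate T i) 0 0

/-- `(π, T)` are phase-type parameters: `π` is a probability vector on the `p` states, `T` is a
sub-intensity matrix, and the `p` states are transient. For a finite chain with one further,
absorbing, state the last condition means that the absorbing state is accessible from all states. -/
structure IsPhaseTypeParam {p : ℕ} (π : Fin p → ℝ) (T : Matrix (Fin p) (Fin p) ℝ) : Prop where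
  init_nonneg : ∀ i, 0 ≤ π i
  init_sum : ∑ i, π i = 1
  offDiag_nonneg : ∀ i j, i ≠ j → 0 ≤ T i j
  exit_nonneg : ∀ i, 0 ≤ exitRate T i
  transient : ∀ i : Fin p,
    Relation.ReflTransGen (fun a b => 0 < intensity T a b) (Sum.inl i) (Sum.inr ())

/-- The initial distribution on the whole state space (no mass at the absorbing state). -/
def initDist {p : ℕ} (π : Fin p → ℝ) : State p → ℝ :=
  Sum.elim π (fun _ => 0)

/-- `X` is a Markov jump process with initial distribution `π` and intensity matrix `intensity T`:
a process with almost surely right-continuous paths in the discrete state space whose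
finite-dimensional distributions are those of the Markov chain with transition semigroup
`exp (s Λ)`. -/
structure IsMarkovJumpProcess {p : ℕ} (π : Fin p → ℝ) (T : Matrix (Fin p) (Fin p) ℝ)
    {Ω : Type*} [MeasurableSpace Ω] (P : Measure Ω) (X : ℝ≥0 → Ω → State p) : Prop where
  measurable : ∀ s, Measurable (X s)
  rightCont : ∀ᵐ ω ∂P, ∀ s, ∀ᶠ r in nhdsWithin s (Set.Ici s), X r ω = X s ω
  finDim : ∀ (m : ℕ) (s : Fin (m + 1) → ℝ≥0) (x : Fin (m + 1) → State p),
    s 0 = 0 → Monotone s →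
      P.real {ω | ∀ k, X (s k) ω = x k} =
        initDist π (x 0) * ∏ k : Fin m,
          NormedSpace.exp (((s k.succ : ℝ) - (s k.castSucc : ℝ)) • intensity T)
            (x k.castSucc) (x k.succ)

/-- The absorption time `τ = inf {s > 0 | X s is the absorbing state}` (`∞` if there is no such
`s`). -/
def absorptionTime {p : ℕ} {Ω : Type*} (X : ℝ≥0 → Ω → State p) (ω : Ω) : ℝ≥0∞ :=
  sInf ((fun s : ℝ≥0 => (s : ℝ≥0∞)) '' {s | 0 < s ∧ X s ω = Sum.inr ()})

open Classical in
/-- The total rewards `Y k = ∫_0^τ ∑ i, R i k 1{X s = i} ds` earned before absorption. -/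
def totalReward {p n : ℕ} (R : Matrix (Fin p) (Fin n) ℝ) {Ω : Type*}
    (X : ℝ≥0 → Ω → State p) (ω : Ω) : Fin n → ℝ := fun k =>
  ∫ s in {s : ℝ | 0 ≤ s ∧ ENNReal.ofReal s < absorptionTime X ω},
    ∑ i : Fin p, R i k * (if X s.toNNReal ω = Sum.inl i then 1 else 0)

/-- `ν` is the Kulkarni multivariate phase-type distribution `MPH*(π, T, R)`: the law of the vector
of total rewards of a Markov jump process with parameters `π` and `T`. -/
def IsMPHStar {p n : ℕ} (π : Fin p → ℝ) (T : Matrix (Fin p) (Fin p) ℝ)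
    (R : Matrix (Fin p) (Fin n) ℝ) (ν : Measure (Fin n → ℝ)) : Prop :=
  ∃ (Ω : Type u) (_ : MeasurableSpace Ω) (P : Measure Ω) (X : ℝ≥0 → Ω → State p),
    IsProbabilityMeasure P ∧ IsMarkovJumpProcess π T P X ∧ HasLaw (totalReward R X) ν P

/-- The random vector `Y` has Laplace transform `L` on the nonnegative orthant. -/
def HasLaplaceTransform {n : ℕ} {Ω : Type*} [MeasurableSpace Ω] (P : Measure Ω)
    (Y : Ω → Fin n → ℝ) (L : (Fin n → ℝ) → ℝ) : Prop :=
  ∀ θ : Fin n → ℝ, (∀ k, 0 ≤ θ k) →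
    Integrable (fun ω => Real.exp (-(Y ω ⬝ᵥ θ))) P ∧
      ∫ ω, Real.exp (-(Y ω ⬝ᵥ θ)) ∂P = L θ

/-- The function `θ ↦ π (Δ(R θ)^α - T)⁻¹ t`. -/
def fractionalLaplace {p n : ℕ} (α : ℝ) (π : Fin p → ℝ) (T : Matrix (Fin p) (Fin p) ℝ)
    (R : Matrix (Fin p) (Fin n) ℝ) (θ : Fin n → ℝ) : ℝ :=
  π ⬝ᵥ ((Matrix.diagonal (fun i => (R *ᵥ θ) i ^ α) - T)⁻¹ *ᵥ exitRate T)

/-- The random variable `S` has the positive stable law with Laplace transform `exp (-u ^ α)`. -/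
def IsPositiveStable {Ω : Type*} [MeasurableSpace Ω] (P : Measure Ω) (α : ℝ) (S : Ω → ℝ) : Prop :=
  ∀ u : ℝ, 0 ≤ u →
    Integrable (fun ω => Real.exp (-(u * S ω))) P ∧
      ∫ ω, Real.exp (-(u * S ω)) ∂P = Real.exp (-u ^ α)

end

end PhaseType

/-! Condition on `W = w` with `w ≥ 0`. By independence the stable transforms multiply, and `((Rθ)_i
w_i^(1/α))^α = (Rθ)_i^α w_i`, so the conditional transform of the mixture at `θ` is `exp(-⟨w,
(Rθ)^α⟩)`. Integrating over `w` gives the transform of `MPH*(π, T, I)` at `(Rθ)^α`, which is the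
prescribed transform of `Y`. Two facts carry this.

Uniqueness (`HasLaplaceTransform.identDistrib`): a transform bounded on the orthant forces almost
sure nonnegativity, and on the orthant the functions `exp(-⟨·, θ⟩)` are bounded, closed under
products and separate points, hence determine finite measures.

The transform of the occupation times (`integral_exp_neg_totalReward`), of Feynman–Kac type: if `Λv
= cv`, with `c = θ` on the transient states and `c = 0` at absorption, then `exp(-∫₀ᵗ c(X_s) ds)
v(X_t)` has constant expectation. The solution `v` has the entries of `(Δ(θ) - T)⁻¹ t` on the
transient states and the value 1 at absorption; let `t → ∞`. Only finite-dimensional distributions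
and right-continuity are given, so the exponential functional is discretized by Riemann sums. -/

section

/-! ### Uniqueness of Laplace transforms on the orthant -/

open Filter Topology BoundedContinuousFunction

namespace PhaseType

/-- A real random variable whose Laplace transform is bounded on the half-line is nonnegative. -/
theorem ae_nonneg_of_laplace_le {Ω : Type*} [MeasurableSpace Ω] {P : Measure Ω}
    [IsFiniteMeasure P] {Z : Ω → ℝ} {C : ℝ}
    (hint : ∀ u : ℝ, 0 ≤ u → Integrable (fun ω => Real.exp (-(u * Z ω))) P)
    (hle : ∀ u : ℝ, 0 ≤ u → ∫ ω, Real.exp (-(u * Z ω)) ∂P ≤ C) :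
    ∀ᵐ ω ∂P, 0 ≤ Z ω := by
  have key : ∀ m : ℕ, P {ω | Z ω ≤ -(1 / ((m : ℝ) + 1))} = 0 := by
    intro m
    set ε : ℝ := 1 / ((m : ℝ) + 1) with hε
    have hεpos : 0 < ε := by positivity
    -- Chernoff bound: the left side blows up as `u → ∞` unless the event is null.
    have hbound : ∀ u : ℝ, 0 ≤ u → Real.exp (u * ε) * P.real {ω | Z ω ≤ -ε} ≤ C := by
      intro u hu
      have h1 := mul_meas_ge_le_integral_of_nonneg
        (ae_of_all P fun ω => (Real.exp_pos (-(u * Z ω))).le) (hint u hu) (Real.exp (u * ε))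
      refine le_trans ?_ (h1.trans (hle u hu))
      refine mul_le_mul_of_nonneg_left (measureReal_mono ?_) (Real.exp_pos _).le
      intro ω hω
      have hω' : Z ω ≤ -ε := hω
      show Real.exp (u * ε) ≤ Real.exp (-(u * Z ω))
      exact Real.exp_le_exp.2 (by nlinarith)
    by_contra hne
    have hpos : 0 < P.real {ω | Z ω ≤ -ε} :=
      ENNReal.toReal_pos hne (measure_ne_top _ _)
    have htend : Tendsto (fun u : ℝ => Real.exp (u * ε) * P.real {ω | Z ω ≤ -ε}) atTop atTop :=
      (Real.tendsto_exp_atTop.comp (tendsto_id.atTop_mul_const hεpos)).atTop_mul_const hpos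
    obtain ⟨u, hu0, hu⟩ := ((eventually_ge_atTop 0).and (htend.eventually_gt_atTop C)).exists
    exact absurd (hbound u hu0) (not_le.2 hu)
  have hall : ∀ᵐ ω ∂P, ∀ m : ℕ, ¬ Z ω ≤ -(1 / ((m : ℝ) + 1)) :=
    ae_all_iff.2 fun m => by simpa [ae_iff] using key m
  filter_upwards [hall] with ω hω
  by_contra hneg
  obtain ⟨m, hm⟩ := exists_nat_one_div_lt (neg_pos.2 (not_le.1 hneg))
  exact hω m (by linarith)

/-- The bounded continuous function `z ↦ exp (-⟨z, θ⟩)` on the nonnegative orthant. -/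
noncomputable def expNeg {n : ℕ} (θ : Fin n → ℝ≥0) : (Fin n → ℝ≥0) →ᵇ ℝ :=
  BoundedContinuousFunction.ofNormedAddCommGroup
    (fun z => Real.exp (-∑ k, (z k : ℝ) * θ k)) (by fun_prop) 1 (by
      intro z
      rw [Real.norm_eq_abs, Real.abs_exp, Real.exp_le_one_iff, neg_nonpos]
      positivity)

theorem expNeg_apply {n : ℕ} (θ z : Fin n → ℝ≥0) :
    expNeg θ z = Real.exp (-∑ k, (z k : ℝ) * θ k) := rfl

theorem expNeg_mul {n : ℕ} (θ η : Fin n → ℝ≥0) : expNeg θ * expNeg η = expNeg (θ + η) := by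
  ext z
  simp [expNeg_apply, ← Real.exp_add, mul_add, Finset.sum_add_distrib, add_comm]

theorem expNeg_zero {n : ℕ} : expNeg (0 : Fin n → ℝ≥0) = 1 := by
  ext z
  simp [expNeg_apply]

/-- The functions `z ↦ exp (-⟨z, θ⟩)` as a submonoid of the bounded continuous functions. -/
noncomputable def expNegSubmonoid (n : ℕ) : Submonoid ((Fin n → ℝ≥0) →ᵇ ℝ) where
  carrier := Set.range expNeg
  one_mem' := ⟨0, expNeg_zero⟩
  mul_mem' := by
    rintro _ _ ⟨θ, rfl⟩ ⟨η, rfl⟩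
    exact ⟨θ + η, (expNeg_mul θ η).symm⟩

/-- The star subalgebra generated by the functions `z ↦ exp (-⟨z, θ⟩)`. -/
noncomputable def expNegSubalgebra (n : ℕ) : StarSubalgebra ℝ ((Fin n → ℝ≥0) →ᵇ ℝ) where
  toSubalgebra := Algebra.adjoin ℝ (expNegSubmonoid n : Set ((Fin n → ℝ≥0) →ᵇ ℝ))
  star_mem' := by
    intro f hf
    have : star f = f := by ext z; simp
    rwa [this]

/-- If `x` and `y` differ in coordinate `k`, then `z ↦ exp(-z_k)` already tells them apart. -/
theorem separatesPoints_expNegSubalgebra (n : ℕ) :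
    ((expNegSubalgebra n).map (toContinuousMapStarₐ ℝ)).SeparatesPoints := by
  intro x y hxy
  obtain ⟨k, hk⟩ := Function.ne_iff.1 hxy
  refine ⟨expNeg (Pi.single k 1), ⟨toContinuousMapStarₐ ℝ (expNeg (Pi.single k 1)),
    ⟨expNeg (Pi.single k 1), ?_, rfl⟩, rfl⟩, ?_⟩
  · exact Algebra.subset_adjoin ⟨_, rfl⟩
  · show expNeg (Pi.single k 1) x ≠ expNeg (Pi.single k 1) y
    simp only [expNeg_apply, ne_eq, Real.exp_eq_exp, neg_inj]
    have hsum : ∀ w : Fin n → ℝ≥0,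
        ∑ j, (w j : ℝ) * ((Pi.single k 1 : Fin n → ℝ≥0) j : ℝ) = w k := by
      intro w
      rw [Finset.sum_eq_single k] <;> simp +contextual
    simpa only [hsum, NNReal.coe_inj] using hk

/-- Finite measures on the nonnegative orthant with equal Laplace transforms are equal. -/
theorem measure_ext_of_laplace {n : ℕ} {μ ν : Measure (Fin n → ℝ≥0)} [IsFiniteMeasure μ]
    [IsFiniteMeasure ν] (h : ∀ θ, ∫ z, expNeg θ z ∂μ = ∫ z, expNeg θ z ∂ν) : μ = ν := by
  refine ext_of_forall_mem_subalgebra_integral_eq_of_pseudoEMetric_complete_countable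
    (separatesPoints_expNegSubalgebra n) fun g hg => ?_
  -- The exponentials are closed under products, so the algebra they generate is their linear span
  -- and linearity of the integral suffices.
  have hg' : g ∈ Submodule.span ℝ (expNegSubmonoid n : Set ((Fin n → ℝ≥0) →ᵇ ℝ)) := by
    have h1 : g ∈ Algebra.adjoin ℝ (expNegSubmonoid n : Set ((Fin n → ℝ≥0) →ᵇ ℝ)) := hg
    rw [← Subalgebra.mem_toSubmodule, Algebra.adjoin_eq_span, Submonoid.closure_eq] at h1
    exact h1
  clear hg
  induction hg' using Submodule.span_induction with
  | mem f hf =>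
    obtain ⟨θ, rfl⟩ := hf
    exact h θ
  | zero => simp
  | add f g _ _ hf hg =>
    have e1 := integral_add (f.integrable μ) (g.integrable μ)
    have e2 := integral_add (f.integrable ν) (g.integrable ν)
    simp only [BoundedContinuousFunction.coe_add, Pi.add_apply]
    rw [e1, e2, hf, hg]
  | smul a f _ hf =>
    simp only [BoundedContinuousFunction.coe_smul, integral_smul]
    rw [hf]

/-- Along the ray `θ = u e_k` the transform is that of the single coordinate `Y_k`, to which the
scalar case applies. -/
theorem HasLaplaceTransform.ae_nonneg {n : ℕ} {Ω : Type*} [MeasurableSpace Ω] {P : Measure Ω}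
    [IsFiniteMeasure P] {Y : Ω → Fin n → ℝ} {L : (Fin n → ℝ) → ℝ} {C : ℝ}
    (hY : HasLaplaceTransform P Y L) (hL : ∀ θ, (∀ k, 0 ≤ θ k) → L θ ≤ C) :
    ∀ᵐ ω ∂P, ∀ k, 0 ≤ Y ω k := by
  refine ae_all_iff.2 fun k => ?_
  have hθ : ∀ u : ℝ, 0 ≤ u → ∀ j, 0 ≤ (Pi.single k u : Fin n → ℝ) j := by
    intro u hu j
    rw [Pi.single_apply]
    split_ifs <;> simp [hu]
  have hdot : ∀ (u : ℝ) ω, Y ω ⬝ᵥ Pi.single k u = u * Y ω k := fun u ω => by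
    rw [dotProduct_single, mul_comm]
  refine ae_nonneg_of_laplace_le (C := C) (fun u hu => ?_) (fun u hu => ?_)
  · simpa only [hdot] using (hY _ (hθ u hu)).1
  · have := (hY _ (hθ u hu)).2
    simp only [hdot] at this
    exact this.trans_le (hL _ (hθ u hu))

/-- A random vector with bounded Laplace transform has its law on the nonnegative orthant. -/
theorem HasLaplaceTransform.exists_orthant {n : ℕ} {Ω : Type*} [MeasurableSpace Ω]
    {P : Measure Ω} [IsFiniteMeasure P] {Y : Ω → Fin n → ℝ} {L : (Fin n → ℝ) → ℝ} {C : ℝ}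
    (hYm : AEMeasurable Y P) (hY : HasLaplaceTransform P Y L)
    (hL : ∀ θ, (∀ k, 0 ≤ θ k) → L θ ≤ C) :
    ∃ μ : Measure (Fin n → ℝ≥0), IsFiniteMeasure μ ∧
      (∀ θ : Fin n → ℝ≥0, ∫ z, expNeg θ z ∂μ = L fun k => θ k) ∧
      μ.map (fun z k => (z k : ℝ)) = P.map Y := by
  let f : (Fin n → ℝ) → Fin n → ℝ≥0 := fun y k => (y k).toNNReal
  have hf : Measurable f := by fun_prop
  have hg : Measurable fun (z : Fin n → ℝ≥0) k => (z k : ℝ) := by fun_prop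
  have hfY : AEMeasurable (fun ω => f (Y ω)) P := hf.comp_aemeasurable hYm
  have hgf : (fun ω k => (f (Y ω) k : ℝ)) =ᵐ[P] Y := by
    filter_upwards [hY.ae_nonneg hL] with ω hω
    ext k
    exact Real.coe_toNNReal _ (hω k)
  refine ⟨P.map fun ω => f (Y ω), inferInstance, fun θ => ?_, ?_⟩
  · rw [integral_map hfY (expNeg θ).continuous.aestronglyMeasurable,
      ← (hY (fun k => θ k) fun k => (θ k).coe_nonneg).2]
    refine integral_congr_ae ?_
    filter_upwards [hgf] with ω hω
    nth_rewrite 2 [← hω]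
    rfl
  · rw [AEMeasurable.map_map_of_aemeasurable hg.aemeasurable hfY]
    exact Measure.map_congr hgf

/-- Uniqueness of bounded Laplace transforms on the nonnegative orthant. -/
theorem HasLaplaceTransform.identDistrib {n : ℕ} {Ω : Type*} [MeasurableSpace Ω] {P : Measure Ω}
    [IsFiniteMeasure P] {Ω' : Type*} [MeasurableSpace Ω'] {P' : Measure Ω'} [IsFiniteMeasure P']
    {Y : Ω → Fin n → ℝ} {Z : Ω' → Fin n → ℝ} {L : (Fin n → ℝ) → ℝ} {C : ℝ}
    (hYm : AEMeasurable Y P) (hZm : AEMeasurable Z P')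
    (hY : HasLaplaceTransform P Y L) (hZ : HasLaplaceTransform P' Z L)
    (hL : ∀ θ, (∀ k, 0 ≤ θ k) → L θ ≤ C) : IdentDistrib Y Z P P' := by
  obtain ⟨μ, _, hμ, hμY⟩ := hY.exists_orthant hYm hL
  obtain ⟨ν, _, hν, hνZ⟩ := hZ.exists_orthant hZm hL
  refine ⟨hYm, hZm, ?_⟩
  rw [← hμY, ← hνZ, measure_ext_of_laplace fun θ => (hμ θ).trans (hν θ).symm]

end PhaseType

end

/-! ### Sub-intensity matrices and the maximum principle -/

section

open Filter Topology

namespace PhaseType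

section Algebra

variable {p : ℕ} {T : Matrix (Fin p) (Fin p) ℝ}

/-- The number `b` is the boundary value at absorption: 0 for mean absorption times, 1 for Laplace
transforms. -/
theorem intensity_mulVec_elim (T : Matrix (Fin p) (Fin p) ℝ) (a : Fin p → ℝ) (b : ℝ) :
    intensity T *ᵥ Sum.elim a (fun _ => b) = Sum.elim (T *ᵥ a + b • exitRate T) 0 := by
  ext x
  rcases x with i | i
  · simp [intensity, Matrix.mulVec, dotProduct, mul_comm]
  · simp [intensity, Matrix.mulVec, dotProduct]

theorem sum_offDiag (T : Matrix (Fin p) (Fin p) ℝ) (i : Fin p) :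
    ∑ j ∈ Finset.univ.erase i, T i j = -T i i - exitRate T i := by
  have h1 : exitRate T i = -∑ j, T i j := by simp [exitRate, Matrix.mulVec, dotProduct]
  rw [h1, ← Finset.add_sum_erase _ _ (Finset.mem_univ i)]
  ring

/-- Maximum principle: a sub-intensity matrix with transient states, minus a nonnegative diagonal
matrix, is injective. -/
theorem IsPhaseTypeParam.eq_zero_of_mulVec_eq {π : Fin p → ℝ} (h : IsPhaseTypeParam π T)
    {θ z : Fin p → ℝ} (hθ : ∀ i, 0 ≤ θ i) (hz : T *ᵥ z = fun i => θ i * z i) : z = 0 := by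
  by_contra hne
  obtain ⟨k, hk⟩ := Function.ne_iff.1 hne
  have : Nonempty (Fin p) := ⟨k⟩
  obtain ⟨m, hm⟩ := Finite.exists_max fun i => |z i|
  set M := |z m| with hM
  have hMpos : 0 < M := (abs_pos.2 hk).trans_le (hm k)
  -- Row `i` of the equation at a maximum of `|z|`. All terms on the left are nonnegative, so each
  -- of them vanishes.
  have key : ∀ i, |z i| = M →
      M * exitRate T i + ∑ j ∈ Finset.univ.erase i, T i j * (M - |z j|) ≤ 0 := by
    intro i hi
    have h1 : (θ i - T i i) * z i = ∑ j ∈ Finset.univ.erase i, T i j * z j := by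
      have := congrFun hz i
      simp only [Matrix.mulVec, dotProduct] at this
      rw [← Finset.add_sum_erase _ _ (Finset.mem_univ i)] at this
      linarith
    have h2 : |∑ j ∈ Finset.univ.erase i, T i j * z j| ≤
        ∑ j ∈ Finset.univ.erase i, T i j * |z j| := by
      refine (Finset.abs_sum_le_sum_abs _ _).trans_eq (Finset.sum_congr rfl fun j hj => ?_)
      rw [abs_mul, abs_of_nonneg (h.offDiag_nonneg i j (Finset.ne_of_mem_erase hj).symm)]
    have h3 : (θ i - T i i) * M ≤ |∑ j ∈ Finset.univ.erase i, T i j * z j| := by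
      rw [← h1, abs_mul, hi]
      exact mul_le_mul_of_nonneg_right (le_abs_self _) hMpos.le
    have h4 : ∑ j ∈ Finset.univ.erase i, T i j * (M - |z j|) =
        (-T i i - exitRate T i) * M - ∑ j ∈ Finset.univ.erase i, T i j * |z j| := by
      rw [← sum_offDiag, Finset.sum_mul, ← Finset.sum_sub_distrib]
      exact Finset.sum_congr rfl fun j _ => by ring
    have h5 := mul_nonneg (hθ i) hMpos.le
    nlinarith
  have hterm : ∀ i, |z i| = M → ∀ j ∈ Finset.univ.erase i, 0 ≤ T i j * (M - |z j|) :=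
    fun i _ j hj => mul_nonneg (h.offDiag_nonneg i j (Finset.ne_of_mem_erase hj).symm)
      (sub_nonneg.2 (hm j))
  -- Maximality of `|z|` propagates along positive rates, and a positive exit rate at a maximum
  -- contradicts `key`. Hence absorption could never be reached from `m`.
  have hreach : ∀ y, Relation.ReflTransGen (fun a b => 0 < intensity T a b) (Sum.inl m) y →
      ∃ j, y = Sum.inl j ∧ |z j| = M := by
    intro y hy
    induction hy with
    | refl => exact ⟨m, rfl, rfl⟩
    | @tail b c _ hbc ih =>
      obtain ⟨i, rfl, hi⟩ := ih
      have hk := key i hi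
      have hs := Finset.sum_nonneg (hterm i hi)
      have he := mul_nonneg hMpos.le (h.exit_nonneg i)
      rcases c with j | u
      · refine ⟨j, rfl, ?_⟩
        have hT : 0 < T i j := hbc
        rcases eq_or_ne j i with rfl | hji
        · exact hi
        have hmem : j ∈ Finset.univ.erase i := Finset.mem_erase.2 ⟨hji, Finset.mem_univ _⟩
        have h1 := Finset.single_le_sum (hterm i hi) hmem
        have h2 := hm j
        by_contra hcon
        have h3 : 0 < M - |z j| := sub_pos.2 (lt_of_le_of_ne h2 hcon)
        have := mul_pos hT h3
        linarith
      · have hT : 0 < exitRate T i := hbc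
        have := mul_pos hMpos hT
        linarith
  obtain ⟨j, hj, -⟩ := hreach _ (h.transient m)
  exact absurd hj (by simp)

/-- For `θ ≥ 0` and a vector `b` there is a solution `z` of `T z + b = θ z`. -/
theorem IsPhaseTypeParam.mulVec_inv {π : Fin p → ℝ} (h : IsPhaseTypeParam π T)
    {θ : Fin p → ℝ} (hθ : ∀ i, 0 ≤ θ i) (b : Fin p → ℝ) :
    T *ᵥ ((Matrix.diagonal θ - T)⁻¹ *ᵥ b) + b =
      fun i => θ i * ((Matrix.diagonal θ - T)⁻¹ *ᵥ b) i := by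
  set A := Matrix.diagonal θ - T with hA
  have hdiag : ∀ z, Matrix.diagonal θ *ᵥ z = fun i => θ i * z i := fun z => by
    ext i
    rw [Matrix.mulVec_diagonal]
  -- Injectivity makes the square matrix `A` invertible, so `⁻¹` is a true inverse and not its
  -- default value 0.
  have hinj : Function.Injective A.mulVec := by
    rw [← Matrix.coe_mulVecLin, injective_iff_map_eq_zero]
    intro z hz
    rw [Matrix.mulVecLin_apply, hA, Matrix.sub_mulVec, sub_eq_zero] at hz
    exact h.eq_zero_of_mulVec_eq hθ (by rw [← hz, hdiag])
  have hunit : IsUnit A := Matrix.mulVec_injective_iff_isUnit.1 hinj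
  have hsol : A *ᵥ (A⁻¹ *ᵥ b) = b := by
    rw [Matrix.mulVec_mulVec, Matrix.mul_nonsing_inv _ ((Matrix.isUnit_iff_isUnit_det _).1 hunit),
      Matrix.one_mulVec]
  rw [← hdiag]
  nth_rewrite 2 [← hsol]
  rw [← Matrix.add_mulVec, hA]
  simp

end Algebra

/-! ### Derivatives of matrix exponentials -/

section Exponential

variable {ι : Type*} [Fintype ι] [DecidableEq ι]

theorem hasDerivAt_exp_smul_apply (A : Matrix ι ι ℝ) (t : ℝ) (x y : ι) :
    HasDerivAt (fun s : ℝ => NormedSpace.exp (s • A) x y)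
      ((NormedSpace.exp (t • A) * A) x y) t := by
  -- A norm chosen locally to differentiate the exponential; the statement on entries does not
  -- depend on it.
  let : NormedRing (Matrix ι ι ℝ) := Matrix.linftyOpNormedRing
  let : NormedAlgebra ℝ (Matrix ι ι ℝ) := Matrix.linftyOpNormedAlgebra
  have h := hasDerivAt_exp_smul_const (𝕂 := ℝ) A t
  let e : Matrix ι ι ℝ →L[ℝ] ℝ := LinearMap.toContinuousLinearMap (Matrix.entryLinearMap ℝ ℝ x y)
  exact e.hasFDerivAt.comp_hasDerivAt t h

/-- If `A f = c f` entrywise, then `exp (h A) (exp (-h c) f) = f + o(h)` as `h → 0`. -/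
theorem hasDerivAt_exp_mulVec_killed (A : Matrix ι ι ℝ) {c f : ι → ℝ}
    (hf : A *ᵥ f = fun y => c y * f y) (x : ι) :
    HasDerivAt (fun h : ℝ => (NormedSpace.exp (h • A) *ᵥ
      fun y => Real.exp (-(h * c y)) * f y) x) 0 0 := by
  have h1 : ∀ y, HasDerivAt (fun h : ℝ => Real.exp (-(h * c y)) * f y) (-(c y * f y)) 0 := by
    intro y
    have := (((hasDerivAt_id (0 : ℝ)).mul_const (c y)).neg.exp).mul_const (f y)
    simpa using this
  have h2 := HasDerivAt.fun_sum (u := Finset.univ) fun y _ =>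
    (hasDerivAt_exp_smul_apply A 0 x y).mul (h1 y)
  have h3 := congrFun hf x
  simp only [Matrix.mulVec, dotProduct] at h3 ⊢
  -- The product rule at 0 gives `A f - c f`, which vanishes by hypothesis.
  refine h2.congr_deriv ?_
  simp [Finset.sum_add_distrib, Matrix.one_apply, h3]

/-- Dynkin's formula in differential form: the derivative of `E g(X_t)` is `E (Ag)(X_t)`. -/
theorem hasDerivAt_dotProduct_exp_mulVec (A : Matrix ι ι ℝ) (a g : ι → ℝ) (t : ℝ) :
    HasDerivAt (fun s : ℝ => a ⬝ᵥ NormedSpace.exp (s • A) *ᵥ g)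
      (a ⬝ᵥ NormedSpace.exp (t • A) *ᵥ (A *ᵥ g)) t := by
  have h2 := HasDerivAt.fun_sum (u := Finset.univ) fun x _ =>
    (HasDerivAt.fun_sum (u := Finset.univ) fun y _ =>
      (hasDerivAt_exp_smul_apply A t x y).mul_const (g y)).const_mul (a x)
  rw [Matrix.mulVec_mulVec]
  exact h2

/-- A zero row of `A` gives a unit row of `exp (t A)`. -/
theorem exp_smul_apply_of_row_eq_zero {A : Matrix ι ι ℝ} {x : ι} (hx : ∀ y, A x y = 0)
    {y : ι} (hxy : x ≠ y) (t : ℝ) : NormedSpace.exp (t • A) x y = 0 := by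
  have hd : ∀ s : ℝ, HasDerivAt (fun s : ℝ => NormedSpace.exp (s • A) x y) 0 s := by
    intro s
    have h := hasDerivAt_exp_smul_apply A s x y
    have hcomm : NormedSpace.exp (s • A) * A = A * NormedSpace.exp (s • A) :=
      ((Commute.refl A).smul_right s).exp_right.symm.eq
    rw [hcomm, Matrix.mul_apply] at h
    simpa [hx] using h
  have hconst := is_const_of_deriv_eq_zero (fun s => (hd s).differentiableAt)
    (fun s => (hd s).deriv) t 0
  simpa [Matrix.one_apply, hxy] using hconst

end Exponential

end PhaseType

end

/-! ### Finite-dimensional expectations and absorption of the jump process -/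

section

open Filter Topology

namespace PhaseType

instance measurableSingletonClass_state (p : ℕ) : MeasurableSingletonClass (State p) where
  measurableSet_singleton x := by
    rcases x with i | u
    · rw [← Set.image_singleton]
      exact (measurableSet_singleton i).inl_image
    · rw [← Set.image_singleton]
      exact (measurableSet_singleton u).inr_image

namespace IsMarkovJumpProcess

variable {p : ℕ} {π : Fin p → ℝ} {T : Matrix (Fin p) (Fin p) ℝ} {Ω : Type*} [MeasurableSpace Ω]
  {P : Measure Ω} {X : ℝ≥0 → Ω → State p}

theorem measurable_comp (h : IsMarkovJumpProcess π T P X) {ι : Type*} [Finite ι] (s : ι → ℝ≥0)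
    (Φ : (ι → State p) → ℝ) : Measurable fun ω => Φ fun k => X (s k) ω :=
  (measurable_of_finite Φ).comp (measurable_pi_lambda _ fun k => h.measurable (s k))

theorem integrable_comp [IsFiniteMeasure P] (h : IsMarkovJumpProcess π T P X) {ι : Type*}
    [Finite ι] (s : ι → ℝ≥0) (Φ : (ι → State p) → ℝ) :
    Integrable (fun ω => Φ fun k => X (s k) ω) P := by
  obtain ⟨C, hC⟩ := (Set.finite_range fun x => ‖Φ x‖).bddAbove
  exact .of_bound (h.measurable_comp s Φ).aestronglyMeasurable C
    (ae_of_all _ fun ω => hC ⟨_, rfl⟩)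

/-- Expectations of functions of finitely many values of the process. -/
theorem integral_comp [IsFiniteMeasure P] (h : IsMarkovJumpProcess π T P X) {m : ℕ}
    {s : Fin (m + 1) → ℝ≥0} (hs0 : s 0 = 0) (hs : Monotone s) (Φ : (Fin (m + 1) → State p) → ℝ) :
    ∫ ω, Φ (fun k => X (s k) ω) ∂P =
      ∑ x, Φ x * (initDist π (x 0) * ∏ k : Fin m,
        NormedSpace.exp (((s k.succ : ℝ) - (s k.castSucc : ℝ)) • intensity T)
          (x k.castSucc) (x k.succ)) := by
  have hV : Measurable fun ω k => X (s k) ω := measurable_pi_lambda _ fun k => h.measurable (s k)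
  rw [← integral_map hV.aemeasurable (measurable_of_finite Φ).aestronglyMeasurable,
    integral_fintype .of_finite]
  refine Finset.sum_congr rfl fun x _ => ?_
  rw [← h.finDim m s x hs0 hs, map_measureReal_apply hV (measurableSet_singleton x), smul_eq_mul,
    mul_comm]
  congr 2
  ext ω
  simp [funext_iff]

/-- The Markov property for the last of finitely many times. -/
theorem integral_comp_mul [IsFiniteMeasure P] (h : IsMarkovJumpProcess π T P X) {m : ℕ}
    {s : Fin (m + 2) → ℝ≥0} (hs0 : s 0 = 0) (hs : Monotone s) (Φ : (Fin (m + 1) → State p) → ℝ)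
    (f : State p → ℝ) :
    ∫ ω, Φ (fun k => X (s k.castSucc) ω) * f (X (s (Fin.last (m + 1))) ω) ∂P =
      ∫ ω, Φ (fun k => X (s k.castSucc) ω) *
        (NormedSpace.exp (((s (Fin.last (m + 1)) : ℝ) - (s (Fin.last m).castSucc : ℝ)) •
          intensity T) *ᵥ f) (X (s (Fin.last m).castSucc) ω) ∂P := by
  rw [h.integral_comp hs0 hs fun x => Φ (fun k => x k.castSucc) * f (x (Fin.last (m + 1))),
    h.integral_comp (s := fun k => s k.castSucc) hs0
      (hs.comp Fin.strictMono_castSucc.monotone) fun x => Φ x * (NormedSpace.exp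
        (((s (Fin.last (m + 1)) : ℝ) - (s (Fin.last m).castSucc : ℝ)) • intensity T) *ᵥ f)
          (x (Fin.last m)),
    -- Split off the last state `a`; summing over it produces the matrix-vector product.
    ← (Fin.snocEquiv fun _ => State p).sum_comp, Fintype.sum_prod_type_right]
  refine Finset.sum_congr rfl fun y _ => ?_
  simp only [Matrix.mulVec, dotProduct, Finset.mul_sum, Finset.sum_mul]
  refine Finset.sum_congr rfl fun a _ => ?_
  have e0 : (Fin.snoc y a : Fin (m + 2) → State p) 0 = y 0 :=
    Fin.snoc_castSucc (α := fun _ => State p) a y 0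
  have e1 : ∀ k : Fin (m + 1), (Fin.snoc y a : Fin (m + 2) → State p) k.castSucc = y k :=
    Fin.snoc_castSucc (α := fun _ => State p) a y
  have e2 : (Fin.snoc y a : Fin (m + 2) → State p) (Fin.last (m + 1)) = a :=
    Fin.snoc_last (α := fun _ => State p) a y
  simp only [Fin.snocEquiv_apply, Fin.prod_univ_castSucc, e0, e1, e2, Fin.succ_last,
    ← Fin.castSucc_succ]
  ring

theorem integral_zero [IsFiniteMeasure P] (h : IsMarkovJumpProcess π T P X) (f : State p → ℝ) :
    ∫ ω, f (X 0 ω) ∂P = initDist π ⬝ᵥ f := by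
  rw [h.integral_comp (m := 0) (s := fun _ => 0) rfl monotone_const fun x => f (x 0)]
  rw [← (Equiv.funUnique (Fin 1) (State p)).symm.sum_comp]
  simp [dotProduct, mul_comm]

theorem integral_eq [IsFiniteMeasure P] (h : IsMarkovJumpProcess π T P X) (t : ℝ≥0)
    (f : State p → ℝ) :
    ∫ ω, f (X t ω) ∂P = initDist π ⬝ᵥ NormedSpace.exp ((t : ℝ) • intensity T) *ᵥ f := by
  have hmono : Monotone ![0, t] := by
    rw [Fin.monotone_iff_le_succ]
    intro i
    fin_cases i
    simp
  have := h.integral_comp_mul (m := 0) (s := ![0, t]) rfl hmono (fun _ => 1) f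
  simp only [one_mul] at this
  rw [← h.integral_zero]
  simpa using this

/-- The absorbing row of `Λ` is zero, so its exponential gives no transition out of absorption;
apply the Markov property at the times `0, a, b`. -/
theorem ae_absorbed_of_le [IsFiniteMeasure P] (h : IsMarkovJumpProcess π T P X) {a b : ℝ≥0}
    (hab : a ≤ b) : ∀ᵐ ω ∂P, X a ω = Sum.inr () → X b ω = Sum.inr () := by
  classical
  let f : State p → ℝ := fun x => if x = Sum.inr () then 0 else 1
  let χ : State p → ℝ := fun x => if x = Sum.inr () then 1 else 0
  have hmono : Monotone ![0, a, b] := by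
    rw [Fin.monotone_iff_le_succ]
    intro i
    fin_cases i <;> simp [hab]
  have h1 := h.integral_comp_mul (m := 1) (s := ![0, a, b]) rfl hmono (fun x => χ (x 1)) f
  have h2 : ∀ x : State p,
      χ x * (NormedSpace.exp (((b : ℝ) - (a : ℝ)) • intensity T) *ᵥ f) x = 0 := by
    intro x
    by_cases hx : x = Sum.inr ()
    · subst hx
      refine mul_eq_zero_of_right _ ?_
      rw [Matrix.mulVec, dotProduct]
      refine Finset.sum_eq_zero fun y _ => ?_
      by_cases hy : y = Sum.inr ()
      · simp [f, hy]
      · rw [exp_smul_apply_of_row_eq_zero (fun z => ?_) (Ne.symm hy), zero_mul]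
        rcases z with j | j <;> rfl
    · simp [χ, hx]
  have h3 : ∫ ω, χ (X a ω) * f (X b ω) ∂P = 0 := by
    refine Eq.trans h1 ?_
    refine integral_eq_zero_of_ae (ae_of_all _ fun ω => ?_)
    exact h2 (X a ω)
  have h4 : Integrable (fun ω => χ (X a ω) * f (X b ω)) P :=
    h.integrable_comp ![a, b] fun x => χ (x 0) * f (x 1)
  have h5 := (integral_eq_zero_iff_of_nonneg (fun ω => by
    dsimp only [χ, f, Pi.zero_apply]
    split_ifs <;> simp) h4).1 h3
  filter_upwards [h5] with ω hω ha
  by_contra hb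
  simp [χ, f, ha, hb] at hω

/-- Almost surely the process stays in the absorbing state. -/
theorem ae_absorbed [IsFiniteMeasure P] (h : IsMarkovJumpProcess π T P X) :
    ∀ᵐ ω ∂P, ∀ s t, s ≤ t → X s ω = Sum.inr () → X t ω = Sum.inr () := by
  obtain ⟨D, hDc, hD⟩ := TopologicalSpace.exists_countable_dense ℝ≥0
  have hall : ∀ᵐ ω ∂P, ∀ a ∈ D, ∀ b ∈ D, a ≤ b → X a ω = Sum.inr () → X b ω = Sum.inr () := by
    refine (ae_ball_iff hDc).2 fun a _ => (ae_ball_iff hDc).2 fun b _ => ?_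
    by_cases hab : a ≤ b
    · filter_upwards [h.ae_absorbed_of_le hab] with ω hω _ using hω
    · exact ae_of_all _ fun ω hc => absurd hc hab
  filter_upwards [hall, h.rightCont] with ω hω hr s t hst hs
  rcases hst.eq_or_lt with rfl | hst
  · exact hs
  -- Right-continuity makes the path constant just after `u`, which moves any time to a slightly
  -- later one in the countable dense set.
  have hpick : ∀ u v : ℝ≥0, u < v → ∃ q ∈ D, u < q ∧ q < v ∧ X q ω = X u ω := by
    intro u v huv
    obtain ⟨w, hw, hsub⟩ := mem_nhdsGE_iff_exists_Ico_subset.1 (hr u)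
    obtain ⟨q, hqD, hq⟩ := hD.exists_between (lt_min huv hw)
    exact ⟨q, hqD, hq.1, hq.2.trans_le (min_le_left _ _),
      hsub ⟨hq.1.le, hq.2.trans_le (min_le_right _ _)⟩⟩
  obtain ⟨q, hqD, hsq, hqt, hq⟩ := hpick s t hst
  obtain ⟨r, hrD, htr, -, hrX⟩ := hpick t (t + 1) (lt_add_one t)
  rw [← hrX]
  exact hω q hqD r hrD (hqt.trans htr).le (hq.trans hs)

/-- Almost surely the absorbing state is reached. -/
theorem ae_exists_absorbed [IsProbabilityMeasure P] (h : IsMarkovJumpProcess π T P X)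
    (hπT : IsPhaseTypeParam π T) : ∀ᵐ ω ∂P, ∃ t, X t ω = Sum.inr () := by
  -- Heuristically the mean absorption times. Since `Tz = -1`, `E g(X_t)` has derivative `-P(X_t not
  -- absorbed) ≤ -q`; being bounded, it forces `q = 0`.
  set z := (Matrix.diagonal (fun _ : Fin p => (0 : ℝ)) - T)⁻¹ *ᵥ (1 : Fin p → ℝ) with hz
  have hTz : T *ᵥ z = -1 := by
    have := hπT.mulVec_inv (θ := fun _ => 0) (fun _ => le_rfl) 1
    rw [← hz] at this
    rw [eq_neg_iff_add_eq_zero, this]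
    ext i
    simp
  let g : State p → ℝ := Sum.elim z fun _ => 0
  have hg : intensity T *ᵥ g = Sum.elim (-1) (0 : Unit → ℝ) := by
    rw [intensity_mulVec_elim, hTz, zero_smul, add_zero]
  obtain ⟨G, hG⟩ := (Set.finite_range fun x => |g x|).bddAbove
  let φ : ℝ → ℝ := fun t => initDist π ⬝ᵥ NormedSpace.exp (t • intensity T) *ᵥ g
  have hφ : ∀ t : ℝ, 0 ≤ t → |φ t| ≤ G := by
    intro t ht
    have h1 : φ t = ∫ ω, g (X t.toNNReal ω) ∂P := by
      rw [h.integral_eq, Real.coe_toNNReal t ht]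
    rw [h1, ← Real.norm_eq_abs]
    refine (norm_integral_le_of_norm_le_const (ae_of_all _ fun ω => hG ⟨_, rfl⟩)).trans_eq ?_
    simp
  -- Measurability of this event is not needed: only monotonicity of `P` is used.
  set q := P.real {ω | ¬ ∃ t, X t ω = Sum.inr ()} with hq
  have hφd : ∀ t : ℝ, HasDerivAt φ
      (initDist π ⬝ᵥ NormedSpace.exp (t • intensity T) *ᵥ (intensity T *ᵥ g)) t :=
    hasDerivAt_dotProduct_exp_mulVec _ _ _
  have hderiv : ∀ t : ℝ, 0 ≤ t → deriv φ t ≤ -q := by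
    intro t ht
    have hmeas : MeasurableSet {ω | X t.toNNReal ω ≠ Sum.inr ()} :=
      h.measurable t.toNNReal (measurableSet_singleton (Sum.inr ())).compl
    have h1 : deriv φ t = -P.real {ω | X t.toNNReal ω ≠ Sum.inr ()} := by
      have h2 := h.integral_eq t.toNNReal (Sum.elim (-1) 0)
      rw [Real.coe_toNNReal t ht] at h2
      rw [(hφd t).deriv, hg, ← h2, ← integral_indicator_one hmeas, ← integral_neg]
      refine integral_congr_ae (ae_of_all _ fun ω => ?_)
      rcases hX : X t.toNNReal ω with i | u
      · simp [Set.indicator, hX]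
      · simp [Set.indicator, hX]
    rw [h1, neg_le_neg_iff]
    exact measureReal_mono fun ω hω hc => hω ⟨_, hc⟩
  have hle : ∀ t : ℝ, 0 ≤ t → q * t ≤ 2 * G := by
    intro t ht
    have h1 := (convex_Ici (0 : ℝ)).image_sub_le_mul_sub_of_deriv_le
      (f := φ) (C := -q) (fun s _ => (hφd s).continuousAt.continuousWithinAt)
      (fun s _ => (hφd s).differentiableAt.differentiableWithinAt)
      (fun s hs => hderiv s (interior_subset hs)) 0 (Set.mem_Ici.2 le_rfl) t ht ht
    have h2 := abs_le.1 (hφ 0 le_rfl)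
    have h3 := abs_le.1 (hφ t ht)
    linarith
  have hq0 : q = 0 := by
    by_contra hne
    have hpos : 0 < q := lt_of_le_of_ne measureReal_nonneg (Ne.symm hne)
    have hG0 : 0 ≤ G := (abs_nonneg _).trans (hφ 0 le_rfl)
    have := hle ((2 * G + 1) / q) (by positivity)
    rw [mul_div_cancel₀ _ hne] at this
    linarith
  rw [ae_iff]
  exact (measureReal_eq_zero_iff).1 hq0

end IsMarkovJumpProcess

end PhaseType

end

/-! ### Riemann sums and occupation times -/

section

open Filter Topology

namespace PhaseType

/-- Convergence of the Riemann sums with right end points for a bounded right-continuous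
function. -/
theorem tendsto_right_riemann_sum {φ : ℝ → ℝ} {C : ℝ} (hb : ∀ s, |φ s| ≤ C)
    (hr : ∀ s, 0 ≤ s → ContinuousWithinAt φ (Set.Ici s) s) {t : ℝ} (ht : 0 < t) :
    Tendsto (fun N : ℕ => t / ((N : ℝ) + 1) *
      ∑ j ∈ Finset.range (N + 1), φ (((j : ℝ) + 1) * (t / ((N : ℝ) + 1)))) atTop
      (𝓝 (∫ s in 0..t, φ s)) := by
  -- The step function sampling `φ` at the right end of the cell `(jh, (j+1)h]` containing `s`.
  -- Samples approach `s` from the right, so right-continuity and dominated convergence suffice.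
  let ψ : ℕ → ℝ → ℝ := fun N s => φ (⌈s / (t / ((N : ℝ) + 1))⌉₊ * (t / ((N : ℝ) + 1)))
  have hψ : ∀ N, Measurable (ψ N) := fun N =>
    (measurable_of_countable fun k : ℕ => φ (k * (t / ((N : ℝ) + 1)))).comp
      (Nat.measurable_ceil.comp (measurable_id.div_const _))
  have hint : ∀ N a b, IntervalIntegrable (ψ N) volume a b := fun N a b =>
    (intervalIntegrable_const (c := C)).mono_fun (hψ N).aestronglyMeasurable
      (ae_of_all _ fun s => (hb _).trans (le_abs_self C))
  have hsum : ∀ N : ℕ, t / ((N : ℝ) + 1) *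
      ∑ j ∈ Finset.range (N + 1), φ (((j : ℝ) + 1) * (t / ((N : ℝ) + 1))) =
        ∫ s in 0..t, ψ N s := by
    intro N
    set h : ℝ := t / ((N : ℝ) + 1) with hh
    have hpos : 0 < h := by positivity
    have h1 := intervalIntegral.sum_integral_adjacent_intervals (μ := volume) (f := ψ N)
      (a := fun k : ℕ => (k : ℝ) * h) (n := N + 1) fun k _ => hint N _ _
    have h2 : ((N + 1 : ℕ) : ℝ) * h = t := by
      rw [hh]
      push_cast
      field_simp
    simp only [Nat.cast_zero, zero_mul, h2] at h1
    rw [← h1, Finset.mul_sum]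
    refine Finset.sum_congr rfl fun j _ => ?_
    have hlt : (j : ℝ) * h ≤ ((j + 1 : ℕ) : ℝ) * h := by
      push_cast
      nlinarith
    have h3 : ∫ s in (j : ℝ) * h..((j + 1 : ℕ) : ℝ) * h, ψ N s =
        ∫ _ in (j : ℝ) * h..((j + 1 : ℕ) : ℝ) * h, φ (((j : ℝ) + 1) * h) := by
      refine intervalIntegral.integral_congr_ae (ae_of_all _ fun s hs => ?_)
      rw [Set.uIoc_of_le hlt] at hs
      have hc : ⌈s / h⌉₊ = j + 1 := by
        rw [Nat.ceil_eq_iff (by simp)]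
        constructor
        · rw [lt_div_iff₀ hpos]
          simpa using hs.1
        · rw [div_le_iff₀ hpos]
          exact hs.2
      show φ (⌈s / h⌉₊ * h) = _
      rw [hc]
      push_cast
      rfl
    rw [h3, intervalIntegral.integral_const, smul_eq_mul]
    push_cast
    ring
  simp only [hsum]
  refine intervalIntegral.tendsto_integral_filter_of_dominated_convergence (fun _ => C)
    (Eventually.of_forall fun N => (hψ N).aestronglyMeasurable)
    (Eventually.of_forall fun N => ae_of_all _ fun s _ => hb _)
    intervalIntegrable_const (ae_of_all _ fun s hs => ?_)
  rw [Set.uIoc_of_le ht.le] at hs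
  refine (hr s hs.1.le).tendsto.comp (tendsto_nhdsWithin_iff.2 ⟨?_, ?_⟩)
  · have h0 : Tendsto (fun N : ℕ => s + t / ((N : ℝ) + 1)) atTop (𝓝 (s + 0)) :=
      (tendsto_const_div_atTop_nhds_zero_nat t).comp (tendsto_add_atTop_nat 1)
        |>.congr (fun N => by simp) |>.const_add s
    rw [add_zero] at h0
    refine tendsto_of_tendsto_of_tendsto_of_le_of_le tendsto_const_nhds h0 (fun N => ?_)
      (fun N => ?_)
    · have hpos : 0 < t / ((N : ℝ) + 1) := by positivity
      exact (div_le_iff₀ hpos).1 (Nat.le_ceil _)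
    · have hpos : 0 < t / ((N : ℝ) + 1) := by positivity
      have h1 := (Nat.ceil_lt_add_one (div_nonneg hs.1.le hpos.le)).le
      calc _ ≤ (s / (t / ((N : ℝ) + 1)) + 1) * (t / ((N : ℝ) + 1)) :=
            mul_le_mul_of_nonneg_right h1 hpos.le
        _ = _ := by rw [add_mul, div_mul_cancel₀ _ hpos.ne', one_mul]
  · refine Eventually.of_forall fun N => ?_
    have hpos : 0 < t / ((N : ℝ) + 1) := by positivity
    exact (div_le_iff₀ hpos).1 (Nat.le_ceil _)

section Path

variable {p : ℕ} {Ω : Type*} {X : ℝ≥0 → Ω → State p} {ω : Ω}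

open Classical in
/-- The time spent in the transient state `i` up to time `t`. -/
noncomputable def occupation (X : ℝ≥0 → Ω → State p) (ω : Ω) (t : ℝ) (i : Fin p) : ℝ :=
  ∫ s in 0..t, if X s.toNNReal ω = Sum.inl i then 1 else 0

theorem tendsto_occupation (hr : ∀ s, ∀ᶠ r in nhdsWithin s (Set.Ici s), X r ω = X s ω)
    (θ : Fin p → ℝ) {t : ℝ≥0} (ht : 0 < t) :
    Tendsto (fun N : ℕ => ((t / ((N : ℝ≥0) + 1) : ℝ≥0) : ℝ) * ∑ j ∈ Finset.range (N + 1),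
      (Sum.elim θ 0 : State p → ℝ) (X (((j + 1 : ℕ) : ℝ≥0) * (t / ((N : ℝ≥0) + 1))) ω)) atTop
      (𝓝 (occupation X ω t ⬝ᵥ θ)) := by
  classical
  let φ : Fin p → ℝ → ℝ := fun i s => if X s.toNNReal ω = Sum.inl i then 1 else 0
  have hφ : ∀ i, Tendsto (fun N : ℕ => (t : ℝ) / ((N : ℝ) + 1) *
      ∑ j ∈ Finset.range (N + 1), φ i (((j : ℝ) + 1) * (t / ((N : ℝ) + 1)))) atTop
      (𝓝 (occupation X ω t i)) := by
    intro i
    have h0 : occupation X ω t i = ∫ s in 0..(t : ℝ), φ i s := by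
      unfold occupation
      congr! 3
    rw [h0]
    refine tendsto_right_riemann_sum (C := 1) (fun s => ?_) (fun s _ => ?_) (NNReal.coe_pos.2 ht)
    · dsimp only [φ]
      split_ifs <;> simp
    · have h1 : Tendsto Real.toNNReal (𝓝[≥] s) (𝓝[≥] s.toNNReal) :=
        continuous_real_toNNReal.continuousWithinAt.tendsto_nhdsWithin
          fun r hr => Real.toNNReal_mono hr
      refine tendsto_nhds_of_eventually_eq ?_
      filter_upwards [h1.eventually (hr s.toNNReal)] with r hr
      simp only [φ, hr]
  have hsum : Tendsto (fun N : ℕ => ∑ i, ((t : ℝ) / ((N : ℝ) + 1) *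
      ∑ j ∈ Finset.range (N + 1), φ i (((j : ℝ) + 1) * (t / ((N : ℝ) + 1)))) * θ i) atTop
      (𝓝 (occupation X ω t ⬝ᵥ θ)) :=
    tendsto_finsetSum _ fun i _ => (hφ i).mul_const (θ i)
  refine hsum.congr fun N => ?_
  simp only [mul_assoc, Finset.sum_mul]
  rw [← Finset.mul_sum, Finset.sum_comm]
  push_cast
  congr 1
  refine Finset.sum_congr rfl fun j _ => ?_
  have hco : ((((j : ℝ) + 1) * (t / ((N : ℝ) + 1)) : ℝ)).toNNReal =
      ((j : ℝ≥0) + 1) * (t / ((N : ℝ≥0) + 1)) := by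
    rw [← Real.toNNReal_coe (r := ((j : ℝ≥0) + 1) * (t / ((N : ℝ≥0) + 1)))]
    push_cast
    rfl
  simp only [φ, hco]
  rcases X (((j : ℝ≥0) + 1) * (t / ((N : ℝ≥0) + 1))) ω with k | u
  · simp
  · simp

/-- Once absorbed the path spends no time in transient states, so any horizon `t` past absorption
yields the same integral. -/
theorem totalReward_one_eq_occupation
    (habs : ∀ s t, s ≤ t → X s ω = Sum.inr () → X t ω = Sum.inr ()) {t : ℝ≥0}
    (ht : X t ω = Sum.inr ()) :
    totalReward (1 : Matrix (Fin p) (Fin p) ℝ) X ω = occupation X ω t := by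
  classical
  ext i
  have hA : MeasurableSet {s : ℝ | 0 ≤ s ∧ ENNReal.ofReal s < absorptionTime X ω} :=
    measurableSet_Ici.inter (measurableSet_lt ENNReal.measurable_ofReal measurable_const)
  rw [totalReward, occupation, intervalIntegral.integral_of_le t.coe_nonneg,
    ← integral_indicator hA, ← integral_indicator measurableSet_Ioc]
  refine integral_congr_ae ?_
  -- The two integration domains may disagree at `0` and at `τ` even where `X_s = i`; both points
  -- are null.
  filter_upwards [Measure.ae_ne volume (0 : ℝ),
    Measure.ae_ne volume (absorptionTime X ω).toReal] with s hs0 hsτ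
  have hsum : ∑ j : Fin p, (1 : Matrix (Fin p) (Fin p) ℝ) j i *
      (if X s.toNNReal ω = Sum.inl j then (1 : ℝ) else 0) =
        if X s.toNNReal ω = Sum.inl i then 1 else 0 := by
    rw [Finset.sum_eq_single i]
    · simp
    · intro j _ hj
      simp [hj]
    · simp
  by_cases hX : X s.toNNReal ω = Sum.inl i
  · rcases lt_or_gt_of_ne hs0 with hneg | hpos
    · rw [Set.indicator_of_notMem (fun h => absurd h.1 (not_le.2 hneg)),
        Set.indicator_of_notMem (fun h => absurd h.1 (not_lt.2 hneg.le))]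
    have hlate : ∀ r, X r ω = Sum.inr () → s.toNNReal < r := by
      intro r hr
      by_contra hc
      have := habs r s.toNNReal (not_lt.1 hc) hr
      rw [hX] at this
      simp at this
    have hle : ENNReal.ofReal s ≤ absorptionTime X ω := by
      refine le_sInf ?_
      rintro _ ⟨r, ⟨-, hr⟩, rfl⟩
      exact ENNReal.coe_le_coe.2 (hlate r hr).le
    have hlt : ENNReal.ofReal s < absorptionTime X ω := by
      refine lt_of_le_of_ne hle fun hc => hsτ ?_
      rw [← hc, ENNReal.toReal_ofReal hpos.le]
    have hst : s ≤ t := by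
      rw [← Real.coe_toNNReal s hpos.le]
      exact NNReal.coe_le_coe.2 (hlate t ht).le
    rw [Set.indicator_of_mem (Set.mem_ofPred.2 ⟨hpos.le, hlt⟩),
      Set.indicator_of_mem (show s ∈ Set.Ioc (0 : ℝ) t from ⟨hpos, hst⟩)]
    convert hsum
  · have h0 : (if X s.toNNReal ω = Sum.inl i then (1 : ℝ) else 0) = 0 := if_neg hX
    rw [Set.indicator_apply, Set.indicator_apply]
    simp only [hX, if_false, ite_self]
    split_ifs
    · exact (by convert hsum : _ = _).trans h0
    · rfl

theorem occupation_nonneg {t : ℝ} (ht : 0 ≤ t) (i : Fin p) : 0 ≤ occupation X ω t i := by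
  refine intervalIntegral.integral_nonneg ht fun s _ => ?_
  split_ifs <;> simp

end Path

end PhaseType

end

/-! ### Laplace transform of the occupation times -/

section

open Filter Topology

namespace PhaseType

namespace IsMarkovJumpProcess

variable {p : ℕ} {π : Fin p → ℝ} {T : Matrix (Fin p) (Fin p) ℝ} {Ω : Type*} [MeasurableSpace Ω]
  {P : Measure Ω} {X : ℝ≥0 → Ω → State p}

/-- The discretized exponential functional of the process at mesh `h`. -/
noncomputable def discountedValue (X : ℝ≥0 → Ω → State p) (c v : State p → ℝ) (h : ℝ≥0) (N : ℕ)
    (ω : Ω) : ℝ :=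
  Real.exp (-(h * ∑ j ∈ Finset.range N, c (X (((j + 1 : ℕ) : ℝ≥0) * h) ω))) * v (X (N * h) ω)

theorem integrable_discountedValue [IsFiniteMeasure P] (hX : IsMarkovJumpProcess π T P X)
    (c v : State p → ℝ) (h : ℝ≥0) (N : ℕ) : Integrable (discountedValue X c v h N) P := by
  have h1 := hX.integrable_comp (fun k : Fin (N + 1) => ((k : ℕ) : ℝ≥0) * h) fun x =>
    Real.exp (-(h * ∑ j : Fin N, c (x j.succ))) * v (x (Fin.last N))
  refine h1.congr (ae_of_all _ fun ω => ?_)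
  simp only [discountedValue, Finset.sum_range, Fin.val_succ, Fin.val_last]

/-- Markov property at the last step: its discount factor depends only on the final state and is
absorbed into the terminal function. -/
theorem integral_discountedValue_succ [IsFiniteMeasure P] (hX : IsMarkovJumpProcess π T P X)
    (c v : State p → ℝ) (h : ℝ≥0) (N : ℕ) :
    ∫ ω, discountedValue X c v h (N + 1) ω ∂P =
      ∫ ω, discountedValue X c (NormedSpace.exp ((h : ℝ) • intensity T) *ᵥ
        fun y => Real.exp (-(h * c y)) * v y) h N ω ∂P := by
  have hmono : Monotone fun k : Fin (N + 2) => ((k : ℕ) : ℝ≥0) * h := fun i j hij => by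
    dsimp only
    gcongr
    exact hij
  have h1 := hX.integral_comp_mul (s := fun k : Fin (N + 2) => ((k : ℕ) : ℝ≥0) * h)
    (by simp) hmono (fun x => Real.exp (-(h * ∑ j : Fin N, c (x j.succ))))
    fun y => Real.exp (-(h * c y)) * v y
  have h2 : ((((N + 1 : ℕ) : ℝ≥0) * h : ℝ≥0) : ℝ) - (((N : ℕ) : ℝ≥0) * h : ℝ≥0) = h := by
    push_cast
    ring
  simp only [Fin.val_last, Fin.val_castSucc, Fin.val_succ, h2] at h1
  simp only [discountedValue, Finset.sum_range_succ, Finset.sum_range (n := N), mul_add, neg_add,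
    Real.exp_add]
  rw [← h1]
  simp only [mul_assoc]

/-- Telescoping over the steps: each replaces `v` by its one-step image, and the discount in front
is at most 1 because `c ≥ 0`. -/
theorem abs_integral_discountedValue_sub_le [IsProbabilityMeasure P]
    (hX : IsMarkovJumpProcess π T P X) {c : State p → ℝ} (hc : ∀ x, 0 ≤ c x) (v : State p → ℝ)
    (h : ℝ≥0) (N : ℕ) :
    |∫ ω, discountedValue X c v h N ω ∂P - initDist π ⬝ᵥ v| ≤
      N * ∑ x, |(NormedSpace.exp ((h : ℝ) • intensity T) *ᵥ
        fun y => Real.exp (-(h * c y)) * v y) x - v x| := by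
  set w := NormedSpace.exp ((h : ℝ) • intensity T) *ᵥ fun y => Real.exp (-(h * c y)) * v y with hw
  induction N with
  | zero => simp [discountedValue, hX.integral_zero]
  | succ N ih =>
    have h1 : |∫ ω, discountedValue X c v h (N + 1) ω ∂P - ∫ ω, discountedValue X c v h N ω ∂P| ≤
        ∑ x, |w x - v x| := by
      rw [hX.integral_discountedValue_succ, ← hw,
        ← integral_sub (hX.integrable_discountedValue _ _ _ _)
          (hX.integrable_discountedValue _ _ _ _), ← Real.norm_eq_abs]
      refine (norm_integral_le_of_norm_le_const (C := ∑ x, |w x - v x|)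
        (ae_of_all _ fun ω => ?_)).trans_eq (by simp)
      rw [discountedValue, discountedValue, ← mul_sub, norm_mul, Real.norm_eq_abs, Real.abs_exp,
        Real.norm_eq_abs]
      refine (mul_le_of_le_one_left (abs_nonneg _) ?_).trans
        (Finset.single_le_sum (f := fun x => |w x - v x|) (fun x _ => abs_nonneg _)
          (Finset.mem_univ _))
      rw [Real.exp_le_one_iff, neg_nonpos]
      exact mul_nonneg h.coe_nonneg (Finset.sum_nonneg fun j _ => hc _)
    calc _ ≤ _ := abs_sub_le _ (∫ ω, discountedValue X c v h N ω ∂P) _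
      _ ≤ _ := add_le_add h1 ih
      _ = _ := by push_cast; ring

theorem ae_tendsto_discountedValue (hX : IsMarkovJumpProcess π T P X) (θ : Fin p → ℝ)
    (v : State p → ℝ) {t : ℝ≥0} (ht : 0 < t) :
    ∀ᵐ ω ∂P, Tendsto (fun N : ℕ =>
      discountedValue X (Sum.elim θ 0) v (t / ((N : ℝ≥0) + 1)) (N + 1) ω) atTop
      (𝓝 (Real.exp (-(occupation X ω t ⬝ᵥ θ)) * v (X t ω))) := by
  filter_upwards [hX.rightCont] with ω hω
  have h1 := ((Real.continuous_exp.tendsto _).comp (tendsto_occupation hω θ ht).neg).mul_const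
    (v (X t ω))
  refine h1.congr fun N => ?_
  have h2 : ((N + 1 : ℕ) : ℝ≥0) * (t / ((N : ℝ≥0) + 1)) = t := by
    push_cast
    exact mul_div_cancel₀ _ (by positivity)
  simp only [discountedValue, h2, Function.comp]

theorem norm_discountedValue_le {Ω₀ : Type*} {X : ℝ≥0 → Ω₀ → State p} {c : State p → ℝ} (hc : ∀ x, 0 ≤ c x) {v : State p → ℝ} {K : ℝ}
    (hK : ∀ x, |v x| ≤ K) (h : ℝ≥0) (N : ℕ)
    (ω : Ω₀) : ‖discountedValue X c v h N ω‖ ≤ K := by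
  rw [discountedValue, norm_mul, Real.norm_eq_abs, Real.abs_exp, Real.norm_eq_abs]
  refine (mul_le_of_le_one_left (abs_nonneg _) ?_).trans (hK _)
  rw [Real.exp_le_one_iff, neg_nonpos]
  exact mul_nonneg h.coe_nonneg (Finset.sum_nonneg fun j _ => hc _)

theorem aestronglyMeasurable_discounted [IsFiniteMeasure P] (hX : IsMarkovJumpProcess π T P X)
    (θ : Fin p → ℝ) (v : State p → ℝ) {t : ℝ≥0} (ht : 0 < t) :
    AEStronglyMeasurable (fun ω => Real.exp (-(occupation X ω t ⬝ᵥ θ)) * v (X t ω)) P :=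
  aestronglyMeasurable_of_tendsto_ae atTop
    (fun _ => (hX.integrable_discountedValue _ _ _ _).aestronglyMeasurable)
    (hX.ae_tendsto_discountedValue θ v ht)

/-- If `(Λ - c) v = 0`, then `exp (-∫₀ᵗ c(X)) v(X_t)` has constant expectation. -/
theorem integral_discounted [IsProbabilityMeasure P] (hX : IsMarkovJumpProcess π T P X)
    {θ : Fin p → ℝ} (hθ : ∀ i, 0 ≤ θ i) {v : State p → ℝ}
    (hv : intensity T *ᵥ v = fun y => (Sum.elim θ 0 : State p → ℝ) y * v y) {t : ℝ≥0}
    (ht : 0 < t) :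
    ∫ ω, Real.exp (-(occupation X ω t ⬝ᵥ θ)) * v (X t ω) ∂P = initDist π ⬝ᵥ v := by
  have hc : ∀ x, 0 ≤ (Sum.elim θ 0 : State p → ℝ) x := by
    rintro (i | u)
    · exact hθ i
    · exact le_rfl
  obtain ⟨K, hK⟩ := (Set.finite_range fun x => |v x|).bddAbove
  have hlim := tendsto_integral_of_dominated_convergence (fun _ => K)
    (fun N : ℕ => (hX.integrable_discountedValue (Sum.elim θ 0) v (t / ((N : ℝ≥0) + 1))
      (N + 1)).aestronglyMeasurable) (integrable_const K)
    (fun N => ae_of_all _ fun ω => norm_discountedValue_le hc (fun x => hK ⟨x, rfl⟩) _ _ ω)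
    (hX.ae_tendsto_discountedValue θ v ht)
  let w : ℝ → State p → ℝ := fun h => NormedSpace.exp (h • intensity T) *ᵥ
    fun y => Real.exp (-(h * (Sum.elim θ 0 : State p → ℝ) y)) * v y
  have hw0 : ∀ x, w 0 x = v x := fun x => by simp [w]
  have hmesh : Tendsto (fun N : ℕ => (t : ℝ) / ((N : ℝ) + 1)) atTop (𝓝[≠] 0) := by
    refine tendsto_nhdsWithin_iff.2 ⟨?_, Eventually.of_forall fun N => ?_⟩
    · exact ((tendsto_const_div_atTop_nhds_zero_nat (t : ℝ)).comp
        (tendsto_add_atTop_nat 1)).congr fun N => by simp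
    · have : (0 : ℝ) < t := ht
      exact (by positivity : (t : ℝ) / ((N : ℝ) + 1) ≠ 0)
  -- There are `N + 1` steps, each with error `o(t/(N+1))` since the derivative at 0 vanishes; the
  -- total is `t` times a difference quotient.
  have hslope : ∀ x, Tendsto (fun N : ℕ => ((N + 1 : ℕ) : ℝ) *
      |w ((t : ℝ) / ((N : ℝ) + 1)) x - v x|) atTop (𝓝 0) := by
    intro x
    have h1 := ((hasDerivAt_iff_tendsto_slope.1
      (hasDerivAt_exp_mulVec_killed (intensity T) hv x)).comp hmesh).abs.const_mul (t : ℝ)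
    rw [abs_zero, mul_zero] at h1
    refine h1.congr fun N => ?_
    have htpos : (0 : ℝ) < t := ht
    have hNpos : (0 : ℝ) < (N : ℝ) + 1 := by positivity
    have h2 : slope (fun h => w h x) 0 ((t : ℝ) / ((N : ℝ) + 1)) =
        (((N : ℝ) + 1) / t) * (w ((t : ℝ) / ((N : ℝ) + 1)) x - v x) := by
      rw [slope_def_field, hw0, sub_zero, div_div_eq_mul_div]
      ring
    show (t : ℝ) * |slope (fun h => w h x) 0 ((t : ℝ) / ((N : ℝ) + 1))| = _
    rw [h2, abs_mul, abs_of_pos (div_pos hNpos htpos)]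
    push_cast
    field_simp
  have hbound : Tendsto (fun N : ℕ => ((N + 1 : ℕ) : ℝ) *
      ∑ x, |w ((t : ℝ) / ((N : ℝ) + 1)) x - v x|) atTop (𝓝 0) := by
    have := tendsto_finsetSum Finset.univ fun x _ => hslope x
    simp only [Finset.sum_const_zero, ← Finset.mul_sum] at this
    exact this
  refine tendsto_nhds_unique hlim (tendsto_iff_norm_sub_tendsto_zero.2
    (squeeze_zero (fun _ => norm_nonneg _) (fun N => ?_) hbound))
  have h1 := hX.abs_integral_discountedValue_sub_le hc v (t / ((N : ℝ≥0) + 1)) (N + 1)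
  rw [Real.norm_eq_abs]
  refine h1.trans_eq ?_
  push_cast
  rfl

/-- Laplace transform of the vector of occupation times before absorption. -/
theorem integral_exp_neg_totalReward [IsProbabilityMeasure P] (hX : IsMarkovJumpProcess π T P X)
    (hπT : IsPhaseTypeParam π T) {θ : Fin p → ℝ} (hθ : ∀ i, 0 ≤ θ i) :
    ∫ ω, Real.exp (-(totalReward (1 : Matrix (Fin p) (Fin p) ℝ) X ω ⬝ᵥ θ)) ∂P =
      π ⬝ᵥ ((Matrix.diagonal θ - T)⁻¹ *ᵥ exitRate T) := by
  set z := (Matrix.diagonal θ - T)⁻¹ *ᵥ exitRate T with hz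
  let v : State p → ℝ := Sum.elim z fun _ => 1
  have hv : intensity T *ᵥ v = fun y => (Sum.elim θ 0 : State p → ℝ) y * v y := by
    rw [intensity_mulVec_elim, one_smul, hz, hπT.mulVec_inv hθ]
    ext (i | u)
    · rfl
    · simp
  have hinit : initDist π ⬝ᵥ v = π ⬝ᵥ z := by
    simp [initDist, v, dotProduct]
  obtain ⟨K, hK⟩ := (Set.finite_range fun x => |v x|).bddAbove
  -- Times `N + 1` tend to infinity and stay positive. Past absorption `v = 1` and the occupation
  -- vector is the total reward.
  have hlim := tendsto_integral_of_dominated_convergence (μ := P) (fun _ => K)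
    (F := fun (N : ℕ) ω => Real.exp (-(occupation X ω ((N : ℝ≥0) + 1 : ℝ≥0) ⬝ᵥ θ)) *
      v (X ((N : ℝ≥0) + 1) ω))
    (f := fun ω => Real.exp (-(totalReward (1 : Matrix (Fin p) (Fin p) ℝ) X ω ⬝ᵥ θ)))
    (fun N : ℕ => hX.aestronglyMeasurable_discounted θ v (t := (N : ℝ≥0) + 1) (by positivity))
    (integrable_const K) (fun N => ae_of_all _ fun ω => ?_) ?_
  · rw [← hinit]
    refine tendsto_nhds_unique hlim (tendsto_const_nhds.congr fun N => ?_)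
    exact (hX.integral_discounted hθ hv (by positivity)).symm
  · rw [norm_mul, Real.norm_eq_abs, Real.abs_exp, Real.norm_eq_abs]
    refine (mul_le_of_le_one_left (abs_nonneg _) ?_).trans (hK ⟨_, rfl⟩)
    rw [Real.exp_le_one_iff, neg_nonpos]
    exact Finset.sum_nonneg fun i _ => mul_nonneg (occupation_nonneg (NNReal.coe_nonneg _) i) (hθ i)
  · filter_upwards [hX.ae_absorbed, hX.ae_exists_absorbed hπT] with ω habs ⟨t, ht⟩
    obtain ⟨M, hM⟩ := exists_nat_ge t
    refine tendsto_const_nhds.congr' ?_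
    filter_upwards [eventually_ge_atTop M] with N hN
    have h1 : X ((N : ℝ≥0) + 1) ω = Sum.inr () := by
      refine habs t _ (hM.trans ?_) ht
      exact (Nat.cast_le.2 hN).trans (le_add_of_nonneg_right zero_le_one)
    rw [totalReward_one_eq_occupation habs h1, h1]
    simp [v]

theorem ae_totalReward_nonneg [IsProbabilityMeasure P] (hX : IsMarkovJumpProcess π T P X)
    (hπT : IsPhaseTypeParam π T) :
    ∀ᵐ ω ∂P, ∀ i, 0 ≤ totalReward (1 : Matrix (Fin p) (Fin p) ℝ) X ω i := by
  filter_upwards [hX.ae_absorbed, hX.ae_exists_absorbed hπT] with ω habs ⟨t, ht⟩ i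
  rw [totalReward_one_eq_occupation habs ht]
  exact occupation_nonneg t.coe_nonneg i

end IsMarkovJumpProcess

/-- The law `MPH*(π, T, I)` lives on the nonnegative orthant. -/
theorem IsMPHStar.ae_nonneg {p : ℕ} {π : Fin p → ℝ} {T : Matrix (Fin p) (Fin p) ℝ}
    {ν : Measure (Fin p → ℝ)} (hν : IsMPHStar.{u} π T (1 : Matrix (Fin p) (Fin p) ℝ) ν)
    (hπT : IsPhaseTypeParam π T) : ∀ᵐ w ∂ν, ∀ i, 0 ≤ w i := by
  obtain ⟨Ω, _, P, X, _, hX, hlaw⟩ := hν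
  have hm : MeasurableSet {w : Fin p → ℝ | ∀ i, 0 ≤ w i} := by measurability
  rw [← hlaw.map_eq, ae_map_iff hlaw.aemeasurable hm]
  exact hX.ae_totalReward_nonneg hπT

/-- The Laplace transform of `MPH*(π, T, I)`. -/
theorem IsMPHStar.integral_exp_neg {p : ℕ} {π : Fin p → ℝ} {T : Matrix (Fin p) (Fin p) ℝ}
    {ν : Measure (Fin p → ℝ)} (hν : IsMPHStar.{u} π T (1 : Matrix (Fin p) (Fin p) ℝ) ν)
    (hπT : IsPhaseTypeParam π T) {θ : Fin p → ℝ} (hθ : ∀ i, 0 ≤ θ i) :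
    ∫ w, Real.exp (-(w ⬝ᵥ θ)) ∂ν = π ⬝ᵥ ((Matrix.diagonal θ - T)⁻¹ *ᵥ exitRate T) := by
  obtain ⟨Ω, _, P, X, _, hX, hlaw⟩ := hν
  rw [← hX.integral_exp_neg_totalReward hπT hθ, ← hlaw.map_eq,
    integral_map hlaw.aemeasurable (by
      refine Measurable.aestronglyMeasurable ?_
      unfold dotProduct
      fun_prop)]

end PhaseType

end

/-! ### The stable mixture and the conclusion -/

namespace PhaseType

theorem mulVec_apply_nonneg {p n : ℕ} {R : Matrix (Fin p) (Fin n) ℝ} (hR : ∀ i k, 0 ≤ R i k)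
    {θ : Fin n → ℝ} (hθ : ∀ k, 0 ≤ θ k) (i : Fin p) : 0 ≤ (R *ᵥ θ) i := by
  rw [Matrix.mulVec, dotProduct]
  exact Finset.sum_nonneg fun k _ => mul_nonneg (hR i k) (hθ k)

/-- The Laplace transform of a vector of independent positive stable random variables. -/
theorem integral_exp_neg_stable {p : ℕ} {α : ℝ} {Ω : Type*} [MeasurableSpace Ω] {P : Measure Ω}
    {S : Fin p → Ω → ℝ} (hS : ∀ i, AEMeasurable (S i) P)
    (hSlaw : ∀ i, IsPositiveStable P α (S i)) (hSindep : iIndepFun S P) {u : Fin p → ℝ}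
    (hu : ∀ i, 0 ≤ u i) :
    Integrable (fun s : Fin p → ℝ => Real.exp (-∑ i, u i * s i)) (P.map fun ω i => S i ω) ∧
      ∫ s : Fin p → ℝ, Real.exp (-∑ i, u i * s i) ∂(P.map fun ω i => S i ω) =
        Real.exp (-∑ i, u i ^ α) := by
  have := hSindep.isProbabilityMeasure
  have hprob : ∀ i, IsProbabilityMeasure (P.map (S i)) := fun i =>
    Measure.isProbabilityMeasure_map (hS i)
  have hmeas : ∀ i, Measurable fun x : ℝ => Real.exp (-(u i * x)) := fun i => by fun_prop
  simp only [← Finset.sum_neg_distrib, Real.exp_sum]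
  rw [hSindep.map_fun_eq_pi_map hS]
  constructor
  · refine Integrable.fintype_prod (f := fun i x => Real.exp (-(u i * x))) fun i => ?_
    exact (integrable_map_measure (hmeas i).aestronglyMeasurable (hS i)).2 (hSlaw i _ (hu i)).1
  · rw [integral_fintype_prod_eq_prod fun i x => Real.exp (-(u i * x))]
    refine Finset.prod_congr rfl fun i _ => ?_
    rw [integral_map (hS i) (hmeas i).aestronglyMeasurable]
    exact (hSlaw i _ (hu i)).2

/-- The Laplace transform of `Rᵀ (W ^ (1 / α) • S)`. -/
theorem hasLaplaceTransform_stable_mixture {p n : ℕ} {α : ℝ} (hα0 : 0 < α) {π : Fin p → ℝ}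
    {T : Matrix (Fin p) (Fin p) ℝ} (hπT : IsPhaseTypeParam π T) {R : Matrix (Fin p) (Fin n) ℝ}
    (hR : ∀ i k, 0 ≤ R i k) {Ω : Type*} [MeasurableSpace Ω] {P : Measure Ω}
    [IsProbabilityMeasure P] {W : Ω → Fin p → ℝ} (hW : AEMeasurable W P)
    (hWlaw : IsMPHStar.{w} π T (1 : Matrix (Fin p) (Fin p) ℝ) (P.map W))
    {S : Fin p → Ω → ℝ} (hS : ∀ i, AEMeasurable (S i) P)
    (hSlaw : ∀ i, IsPositiveStable P α (S i)) (hSindep : iIndepFun S P)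
    (hWS : IndepFun W (fun ω i => S i ω) P) :
    HasLaplaceTransform P (fun ω => Rᵀ *ᵥ (fun i => W ω i ^ (1 / α) * S i ω))
      (fractionalLaplace α π T R) := by
  intro θ hθ
  have hRθ : ∀ i, 0 ≤ (R *ᵥ θ) i := mulVec_apply_nonneg hR hθ
  have hSm : AEMeasurable (fun ω i => S i ω) P := aemeasurable_pi_lambda _ hS
  let F : (Fin p → ℝ) × (Fin p → ℝ) → ℝ := fun x =>
    Real.exp (-∑ i, ((R *ᵥ θ) i * x.1 i ^ (1 / α)) * x.2 i)
  have hF : Measurable F := by fun_prop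
  have hFeq : ∀ ω, Real.exp (-((Rᵀ *ᵥ fun i => W ω i ^ (1 / α) * S i ω) ⬝ᵥ θ)) =
      F (W ω, fun i => S i ω) := by
    intro ω
    rw [Matrix.mulVec_transpose, ← Matrix.dotProduct_mulVec]
    simp only [F, dotProduct]
    congr 2
    exact Finset.sum_congr rfl fun i _ => by ring
  have hcoef : ∀ w : Fin p → ℝ, (∀ i, 0 ≤ w i) → ∀ i, 0 ≤ (R *ᵥ θ) i * w i ^ (1 / α) :=
    fun w hw i => mul_nonneg (hRθ i) (Real.rpow_nonneg (hw i) _)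
  -- The transform conditional on `W = w`; the power rules for `rpow` need `w ≥ 0`.
  have hinner : ∀ w : Fin p → ℝ, (∀ i, 0 ≤ w i) →
      ∫ s, F (w, s) ∂(P.map fun ω i => S i ω) =
        Real.exp (-(w ⬝ᵥ fun i => (R *ᵥ θ) i ^ α)) := by
    intro w hw
    refine (integral_exp_neg_stable hS hSlaw hSindep (hcoef w hw)).2.trans ?_
    congr 2
    refine Finset.sum_congr rfl fun i _ => ?_
    rw [Real.mul_rpow (hRθ i) (Real.rpow_nonneg (hw i) _), ← Real.rpow_mul (hw i),
      one_div_mul_cancel hα0.ne', Real.rpow_one, mul_comm]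
  have hWpos := hWlaw.ae_nonneg hπT
  have hWprob : IsProbabilityMeasure (P.map W) := Measure.isProbabilityMeasure_map hW
  have hSprob : IsProbabilityMeasure (P.map fun ω i => S i ω) :=
    Measure.isProbabilityMeasure_map hSm
  have hprod : P.map (fun ω => (W ω, fun i => S i ω)) =
      (P.map W).prod (P.map fun ω i => S i ω) :=
    (indepFun_iff_map_prod_eq_prod_map_map hW hSm).1 hWS
  have hFint : Integrable F ((P.map W).prod (P.map fun ω i => S i ω)) := by
    rw [integrable_prod_iff hF.aestronglyMeasurable]
    constructor
    · filter_upwards [hWpos] with w hw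
      exact (integral_exp_neg_stable hS hSlaw hSindep (hcoef w hw)).1
    · refine Integrable.of_bound
        hF.aestronglyMeasurable.norm.integral_prod_right' 1 ?_
      filter_upwards [hWpos] with w hw
      have h1 : ∀ s, ‖F (w, s)‖ = F (w, s) := fun s => by
        rw [Real.norm_eq_abs, Real.abs_exp]
      simp only [h1]
      rw [hinner w hw, Real.norm_eq_abs, Real.abs_exp, Real.exp_le_one_iff, neg_nonpos]
      exact Finset.sum_nonneg fun i _ => mul_nonneg (hw i) (Real.rpow_nonneg (hRθ i) _)
  have hpair : AEMeasurable (fun ω => (W ω, fun i => S i ω)) P := hW.prodMk hSm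
  simp only [hFeq]
  constructor
  · rw [← hprod] at hFint
    exact (integrable_map_measure hF.aestronglyMeasurable hpair).1 hFint
  · rw [← integral_map hpair hF.aestronglyMeasurable, hprod, integral_prod _ hFint,
      fractionalLaplace, ← hWlaw.integral_exp_neg hπT fun i => Real.rpow_nonneg (hRθ i) α]
    refine integral_congr_ae ?_
    filter_upwards [hWpos] with w hw using hinner w hw

/-- It is the transform, at `(Rθ)^α ≥ 0`, of a probability law on the orthant. This supplies the
bound that uniqueness requires. -/
theorem fractionalLaplace_le_one {p n : ℕ} {α : ℝ} {π : Fin p → ℝ}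
    {T : Matrix (Fin p) (Fin p) ℝ} (hπT : IsPhaseTypeParam π T) {R : Matrix (Fin p) (Fin n) ℝ}
    (hR : ∀ i k, 0 ≤ R i k) {ν : Measure (Fin p → ℝ)} [IsProbabilityMeasure ν]
    (hν : IsMPHStar.{w} π T (1 : Matrix (Fin p) (Fin p) ℝ) ν) {θ : Fin n → ℝ}
    (hθ : ∀ k, 0 ≤ θ k) : fractionalLaplace α π T R θ ≤ 1 := by
  have hRθ : ∀ i, 0 ≤ (R *ᵥ θ) i ^ α := fun i =>
    Real.rpow_nonneg (mulVec_apply_nonneg hR hθ i) _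
  rw [fractionalLaplace, ← hν.integral_exp_neg hπT hRθ]
  refine (le_abs_self _).trans ?_
  rw [← Real.norm_eq_abs]
  refine (norm_integral_le_of_norm_le_const (C := 1) ?_).trans_eq (by simp)
  filter_upwards [hν.ae_nonneg hπT] with w hw
  rw [Real.norm_eq_abs, Real.abs_exp, Real.exp_le_one_iff, neg_nonpos]
  exact Finset.sum_nonneg fun i _ => mul_nonneg (hw i) (hRθ i)

end PhaseType

theorem mainTheorem1 {p n : ℕ} (α : ℝ) (hα0 : 0 < α) (hα1 : α ≤ 1)
    (π : Fin p → ℝ) (T : Matrix (Fin p) (Fin p) ℝ) (hπT : PhaseType.IsPhaseTypeParam π T)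
    (R : Matrix (Fin p) (Fin n) ℝ) (hR : ∀ i k, 0 ≤ R i k)
    {Ω : Type u} [MeasurableSpace Ω] (P : Measure Ω) [IsProbabilityMeasure P]
    (Y : Ω → Fin n → ℝ) (hY : AEMeasurable Y P)
    (hYL : PhaseType.HasLaplaceTransform P Y (PhaseType.fractionalLaplace α π T R))
    {Ω' : Type v} [MeasurableSpace Ω'] (P' : Measure Ω') [IsProbabilityMeasure P']
    (W : Ω' → Fin p → ℝ) (hW : AEMeasurable W P')
    (hWlaw : PhaseType.IsMPHStar.{w} π T (1 : Matrix (Fin p) (Fin p) ℝ) (P'.map W))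
    (S : Fin p → Ω' → ℝ) (hS : ∀ i, AEMeasurable (S i) P')
    (hSlaw : ∀ i, PhaseType.IsPositiveStable P' α (S i))
    (hSindep : iIndepFun S P')
    (hWS : IndepFun W (fun ω i => S i ω) P') :
    IdentDistrib Y (fun ω => Rᵀ *ᵥ (fun i => W ω i ^ (1 / α) * S i ω)) P P' := by
  have : IsProbabilityMeasure (P'.map W) := Measure.isProbabilityMeasure_map hW
  have hmix : AEMeasurable (fun ω => Rᵀ *ᵥ (fun i => W ω i ^ (1 / α) * S i ω)) P' := by
    have hWi : ∀ i, AEMeasurable (fun ω => W ω i) P' := aemeasurable_pi_iff.1 hW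
    refine aemeasurable_pi_lambda _ fun k => ?_
    simp only [Matrix.mulVec, dotProduct]
    exact Finset.aemeasurable_fun_sum _ fun i _ =>
      (((hWi i).pow_const _).mul (hS i)).const_mul _
  exact hYL.identDistrib hY hmix
    (PhaseType.hasLaplaceTransform_stable_mixture hα0 hπT hR hW hWlaw hS hSlaw hSindep hWS)
    fun θ hθ => PhaseType.fractionalLaplace_le_one hπT hR hWlaw hθ
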